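/- Let $U$ be a normal ultrafilter on a measurable cardinal $\delta$, let $\mathrm{Ult}(V,U)$ denote the transitive collapse of the ultrapower of the universe $V$ by $U$, and let $\lambda$ be a limit ordinal. A set $A$ of ordinals is called \emph{fresh} over a class $M$ if $A\notin M$ and $A\cap\alpha\in M$ for every $\alpha<\mathrm{lub}(A)$, where $\mathrm{lub}(A)$ is the least upper bound of $A$. 1. If the cardinal $\mathrm{cf}(\lambda)$ is either smaller than $\delta^+$ or weakly compact, then no unbounded subset of $\lambda$ is fresh over $\mathrm{Ult}(V,U)$. 2. If $\mathrm{cf}(\lambda)>2^\delta$ and there exists a ${<}(2^\delta)^+$-closed ultrafilter on $\mathrm{cf}(\lambda)$ (that is, one closed under intersections of fewer than $(2^\delta)^+$ of its elements) that contains all cobounded subsets of $\mathrm{cf}(\lambda)$, then no unbounded subset of $\lambda$ is fresh over $\mathrm{Ult}(V,U)$. In particular, if there exists a strongly compact cardinal $\kappa$ with $\delta<\kappa\leq\mathrm{cf}(\lambda)$, then no unbounded subset of $\lambda$ is fresh over $\mathrm{Ult}(V,U)$. -/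

import Mathlib

universe u

open Cardinal

/-! The set-theoretic universe `V` is `ZFSet.{u}`; its ordinals and cardinals are `Ordinal.{u}` and
`Cardinal.{u}`, an ordinal `o` being the von Neumann ordinal `o.toZFSet` of `V`.  As an index set,
the cardinal `δ` is the well-ordered type `δ.ord.ToType` of order type `δ`. -/

/-! ### The ultrapower of the universe and its transitive collapse -/

namespace Ultrapower

variable {I : Type u} (U : Ultrafilter I)

/-- The ultrapower of `V` by `U` before collapsing: all functions `I → V` modulo `U`. -/
abbrev Carrier : Type (u + 1) := Filter.Germ (U : Filter I) ZFSet.{u}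

/-- The membership relation of the ultrapower: `[f] E [g]` iff `{i | f i ∈ g i} ∈ U`. -/
def Mem (x y : Carrier U) : Prop := Filter.Germ.LiftRel (· ∈ ·) x y

theorem wellFounded_mem [CountableInterFilter (U : Filter I)] : WellFounded (Mem U) := by
  rw [wellFounded_iff_isEmpty_descending_chain]
  refine ⟨fun ⟨s, hs⟩ => ?_⟩
  choose f hf using fun n => Quotient.exists_rep (s n)
  have key : ∀ n, ∀ᶠ i in (U : Filter I), f (n + 1) i ∈ f n i := by
    intro n
    have h := hs n
    rw [← hf n, ← hf (n + 1)] at h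
    exact h
  obtain ⟨i, hi⟩ := (eventually_countable_forall.2 key).exists
  exact (wellFounded_iff_isEmpty_descending_chain.1 ZFSet.mem_wf).false
    ⟨fun n => f n i, hi⟩

theorem small_mem (x : Carrier U) : Small.{u} {y : Carrier U // Mem U y x} := by
  classical
  obtain ⟨f, rfl⟩ := Quotient.exists_rep x
  let m : (∀ i, {z : ZFSet.{u} // z ∈ insert ∅ (f i)}) → Carrier U :=
    fun g => ((fun i => (g i).1 : I → ZFSet.{u}) : Carrier U)
  have : ∀ i, Small.{u} {z : ZFSet.{u} // z ∈ insert ∅ (f i)} :=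
    fun i => ZFSet.small_coe (insert ∅ (f i))
  have hsub : {y : Carrier U | Mem U y (Quotient.mk _ f)} ⊆ Set.range m := by
    intro y hy
    obtain ⟨g, rfl⟩ := Quotient.exists_rep y
    have hy' : ∀ᶠ i in (U : Filter I), g i ∈ f i := hy
    refine ⟨fun i => if h : g i ∈ f i then ⟨g i, ZFSet.mem_insert_iff.2 (Or.inr h)⟩
      else ⟨∅, ZFSet.mem_insert_iff.2 (Or.inl rfl)⟩, ?_⟩
    refine Filter.Germ.coe_eq.2 ?_
    filter_upwards [hy'] with i hi
    simp [hi]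
  exact small_subset hsub

/-- The transitive (Mostowski) collapse of the ultrapower: the recursion
`collapse x = {collapse y | y E x}` along the well-founded, set-like relation `E`. -/
noncomputable def collapse [CountableInterFilter (U : Filter I)] : Carrier U → ZFSet.{u} :=
  (wellFounded_mem U).fix fun x ih =>
    haveI := small_mem U x
    ZFSet.range fun y : {y : Carrier U // Mem U y x} => ih y.1 y.2

theorem mem_collapse_iff [CountableInterFilter (U : Filter I)] (x : Carrier U) (z : ZFSet.{u}) :
    z ∈ collapse U x ↔ ∃ y, Mem U y x ∧ collapse U y = z := by
  have := small_mem U x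
  rw [collapse, WellFounded.fix_eq, ZFSet.mem_range]
  simp

/-- The class `Ult(V, U)`, as a transitive class of sets. -/
def Ult [CountableInterFilter (U : Filter I)] : Set ZFSet.{u} := Set.range (collapse U)

end Ultrapower

/-! ### Large cardinals -/

/-- `U` is `κ`-complete if it is closed under intersections of fewer than `κ` of its elements
(that is, `U` is `<κ`-closed). -/
abbrev Ultrafilter.IsComplete {I : Type u} (U : Ultrafilter I) (κ : Cardinal.{u}) : Prop :=
  CardinalInterFilter (U : Filter I) κ

/-- `δ` is measurable: uncountable, with a non-principal `δ`-complete ultrafilter on `δ`. -/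
def Cardinal.IsMeasurable (δ : Cardinal.{u}) : Prop :=
  ℵ₀ < δ ∧ ∃ U : Ultrafilter δ.ord.ToType, (∀ ξ, {ξ} ∉ U) ∧ U.IsComplete δ

/-- A normal ultrafilter on `δ`: non-principal, `δ`-complete and closed under diagonal
intersections `{ξ < δ | ∀ α < ξ, ξ ∈ X α}`. -/
structure Ultrafilter.IsNormal {δ : Cardinal.{u}} (U : Ultrafilter δ.ord.ToType) : Prop where
  nonprincipal : ∀ ξ, {ξ} ∉ U
  complete : U.IsComplete δ
  diagonal : ∀ X : δ.ord.ToType → Set δ.ord.ToType, (∀ α, X α ∈ U) →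
    {ξ | ∀ α < ξ, ξ ∈ X α} ∈ U

theorem Ultrafilter.IsNormal.countableInterFilter {δ : Cardinal.{u}}
    {U : Ultrafilter δ.ord.ToType} (hU : U.IsNormal) (hδ : δ.IsMeasurable) :
    CountableInterFilter (U : Filter δ.ord.ToType) :=
  haveI := hU.complete
  CardinalInterFilter.toCountableInterFilter _ hδ.1

/-- `κ` is weakly compact: uncountable, and `κ → (κ)²₂`, i.e. every colouring of the
two-element subsets `{α < β}` of `κ` with two colours has a homogeneous set of size `κ`. -/
def Cardinal.IsWeaklyCompact (κ : Cardinal.{u}) : Prop :=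
  ℵ₀ < κ ∧ ∀ c : κ.ord.ToType → κ.ord.ToType → Bool,
    ∃ (H : Set κ.ord.ToType) (b : Bool), #H = κ ∧ ∀ α ∈ H, ∀ β ∈ H, α < β → c α β = b

/-- `κ` is strongly compact: uncountable, and for every set `S` of size at least `κ` there is
a `κ`-complete fine ultrafilter on `P_κ(S) = {s ⊆ S : |s| < κ}`. -/
def Cardinal.IsStronglyCompact (κ : Cardinal.{u}) : Prop :=
  ℵ₀ < κ ∧ ∀ S : Type u, κ ≤ #S → ∃ W : Ultrafilter {s : Set S // #s < κ},
    W.IsComplete κ ∧ ∀ a : S, {s | a ∈ s.1} ∈ W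

/-- The ultrafilter `F` on the cardinal `μ` contains all cobounded subsets of `μ`. -/
def Ultrafilter.ContainsCobounded {μ : Cardinal.{u}} (F : Ultrafilter μ.ord.ToType) : Prop :=
  ∀ X : Set μ.ord.ToType, (∃ α, ∀ β, α ≤ β → β ∈ X) → X ∈ F

/-! ### Freshness -/

/-- The least upper bound of a set of ordinals. -/
noncomputable def ZFSet.lub (A : ZFSet.{u}) : Ordinal.{u} :=
  sInf {β | ∀ γ : Ordinal.{u}, γ.toZFSet ∈ A → γ ≤ β}

/-- The set of ordinals `A` is fresh over the class `M`. -/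
def ZFSet.IsFreshOver (A : ZFSet.{u}) (M : Set ZFSet.{u}) : Prop :=
  (∀ x ∈ A, x.IsOrdinal) ∧ A ∉ M ∧ ∀ α < A.lub, A ∩ α.toZFSet ∈ M

/-- `A` is an unbounded subset of the ordinal `l`. -/
def ZFSet.IsUnboundedSubset (A : ZFSet.{u}) (l : Ordinal.{u}) : Prop :=
  A ⊆ l.toZFSet ∧ ∀ β < l, ∃ γ, β ≤ γ ∧ γ.toZFSet ∈ A

/-- No unbounded subset of the ordinal `l` is fresh over the class `M`. -/
def NoFreshUnboundedSubset (M : Set ZFSet.{u}) (l : Ordinal.{u}) : Prop :=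
  ∀ A : ZFSet.{u}, A.IsUnboundedSubset l → ¬ A.IsFreshOver M

/-! It suffices that a set `A ⊆ l`, all of whose proper initial segments lie in `Ult U`, lies there
itself.

If `cf(l) ≤ δ`, then `A` is a union of at most `δ` of its segments, and `Ult U` is closed under such
unions: by normality a diagonal union of representing functions represents the union
(`iUnion_mem_Ult`).

If `cf(l) > 2^δ`, choose functions `f a` representing segments cofinal in `A`. Any two cohere on a
set in `U`, but that set depends on the pair. A `δ⁺`-complete filter of tails that decides coherence
at each index replaces these sets by one set `X a ∈ U` per segment. There are only `2^δ` subsets of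
`δ`, so `X a` is constant for cofinally many `a`, and the pointwise union of those `f a` represents
a set that agrees with `A` below `l` (`mem_Ult_of_deciding_filter`).

The filter comes from a homogeneous set for lexicographic comparison (weakly compact), from the
given ultrafilter, or from a fine ultrafilter pushed forward to `cf(l)` (strongly compact). -/

namespace Ultrapower

open Filter

/-! ### Łoś-type facts for the collapsed ultrapower -/

section Ultrafilter

variable {I : Type u} (U : Ultrafilter I)

theorem mem_coe {f g : I → ZFSet.{u}} :
    Mem U (f : Carrier U) (g : Carrier U) ↔ ∀ᶠ i in (U : Filter I), f i ∈ g i :=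
  Iff.rfl

theorem exists_mem_notMem {f g : I → ZFSet.{u}}
    (h : ∀ᶠ i in (U : Filter I), ¬ f i ⊆ g i) :
    ∃ x, Mem U x (f : Carrier U) ∧ ¬ Mem U x (g : Carrier U) := by
  classical
  have hc : ∀ i, ∃ z, ¬ f i ⊆ g i → z ∈ f i ∧ z ∉ g i := by
    intro i
    by_cases hi : f i ⊆ g i
    · exact ⟨∅, fun h => (h hi).elim⟩
    · obtain ⟨z, h1, h2⟩ : ∃ z, z ∈ f i ∧ z ∉ g i := by
        by_contra! h'
        exact hi fun z hz => h' z hz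
      exact ⟨z, fun _ => ⟨h1, h2⟩⟩
  choose z hz using hc
  refine ⟨(z : Carrier U), h.mono fun i hi => (hz i hi).1, fun hg => ?_⟩
  rw [mem_coe] at hg
  obtain ⟨i, hi, hi'⟩ := (h.and hg).exists
  exact (hz i hi).2 hi'

theorem carrier_ext {x y : Carrier U} (h : ∀ z, Mem U z x ↔ Mem U z y) : x = y := by
  induction x using Germ.inductionOn with | _ f
  induction y using Germ.inductionOn with | _ g
  by_contra hne
  have hne' : ∀ᶠ i in (U : Filter I), ¬ f i = g i :=
    Ultrafilter.eventually_not.2 fun h => hne (Germ.coe_eq.2 h)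
  have : ∀ᶠ i in (U : Filter I), ¬ f i ⊆ g i ∨ ¬ g i ⊆ f i := by
    filter_upwards [hne'] with i hi
    by_contra! h'
    exact hi (le_antisymm h'.1 h'.2)
  rcases Ultrafilter.eventually_or.1 this with h' | h'
  · obtain ⟨z, h1, h2⟩ := exists_mem_notMem U h'
    exact h2 ((h z).1 h1)
  · obtain ⟨z, h1, h2⟩ := exists_mem_notMem U h'
    exact h2 ((h z).2 h1)

variable [CountableInterFilter (U : Filter I)]

theorem collapse_injective : Function.Injective (collapse U) := by
  intro x
  induction x using (wellFounded_mem U).induction with | _ x ih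
  intro y hxy
  refine carrier_ext U fun z => ⟨fun hz => ?_, fun hz => ?_⟩
  · have : collapse U z ∈ collapse U y := hxy ▸ (mem_collapse_iff U x _).2 ⟨z, hz, rfl⟩
    obtain ⟨w, hw, hwz⟩ := (mem_collapse_iff U y _).1 this
    rwa [ih z hz hwz.symm]
  · have : collapse U z ∈ collapse U x := hxy ▸ (mem_collapse_iff U y _).2 ⟨z, hz, rfl⟩
    obtain ⟨w, hw, hwz⟩ := (mem_collapse_iff U x _).1 this
    rwa [← ih w hw hwz]

/-- The set represented by a function in the collapsed ultrapower. -/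
noncomputable def rep (f : I → ZFSet.{u}) : ZFSet.{u} := collapse U (f : Carrier U)

theorem mem_Ult_iff {z : ZFSet.{u}} : z ∈ Ult U ↔ ∃ f, rep U f = z := by
  constructor
  · rintro ⟨x, rfl⟩
    induction x using Germ.inductionOn with | _ f
    exact ⟨f, rfl⟩
  · rintro ⟨f, rfl⟩
    exact ⟨_, rfl⟩

theorem rep_mem_Ult (f : I → ZFSet.{u}) : rep U f ∈ Ult U := ⟨_, rfl⟩

theorem rep_eq_rep {f g : I → ZFSet.{u}} :
    rep U f = rep U g ↔ ∀ᶠ i in (U : Filter I), f i = g i :=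
  (collapse_injective U).eq_iff.trans Germ.coe_eq

theorem rep_mem_rep {f g : I → ZFSet.{u}} :
    rep U f ∈ rep U g ↔ ∀ᶠ i in (U : Filter I), f i ∈ g i := by
  rw [rep, rep, mem_collapse_iff]
  constructor
  · rintro ⟨y, hy, h⟩
    rwa [collapse_injective U h] at hy
  · exact fun h => ⟨(f : Carrier U), (mem_coe U).2 h, rfl⟩

theorem mem_rep {z : ZFSet.{u}} {g : I → ZFSet.{u}} :
    z ∈ rep U g ↔ ∃ f, rep U f = z ∧ ∀ᶠ i in (U : Filter I), f i ∈ g i := by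
  constructor
  · intro h
    obtain ⟨y, hy, rfl⟩ := (mem_collapse_iff U _ _).1 h
    induction y using Germ.inductionOn with | _ f
    exact ⟨f, rfl, hy⟩
  · rintro ⟨f, rfl, h⟩
    exact (rep_mem_rep U).2 h

theorem rep_inter (f g : I → ZFSet.{u}) : rep U (fun i => f i ∩ g i) = rep U f ∩ rep U g := by
  ext z
  simp only [ZFSet.mem_inter]
  constructor
  · intro h
    obtain ⟨x, rfl, hx⟩ := (mem_rep U).1 h
    simp only [ZFSet.mem_inter] at hx
    exact ⟨(rep_mem_rep U).2 (hx.mono fun _ h => h.1), (rep_mem_rep U).2 (hx.mono fun _ h => h.2)⟩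
  · rintro ⟨h1, h2⟩
    obtain ⟨x, rfl, hx⟩ := (mem_rep U).1 h1
    rw [rep_mem_rep] at h2 ⊢
    filter_upwards [hx, h2] with i hi hi' using ZFSet.mem_inter.2 ⟨hi, hi'⟩

theorem inter_mem_Ult {x y : ZFSet.{u}} (hx : x ∈ Ult U) (hy : y ∈ Ult U) : x ∩ y ∈ Ult U := by
  obtain ⟨f, rfl⟩ := (mem_Ult_iff U).1 hx
  obtain ⟨g, rfl⟩ := (mem_Ult_iff U).1 hy
  exact rep_inter U f g ▸ rep_mem_Ult U _

theorem isTransitive_Ult {x y : ZFSet.{u}} (hx : x ∈ Ult U) (hy : y ∈ x) : y ∈ Ult U := by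
  obtain ⟨f, rfl⟩ := (mem_Ult_iff U).1 hx
  obtain ⟨g, rfl, -⟩ := (mem_rep U).1 hy
  exact rep_mem_Ult U g

theorem isTransitive_rep {f : I → ZFSet.{u}}
    (hf : ∀ᶠ i in (U : Filter I), (f i).IsTransitive) : (rep U f).IsTransitive := by
  intro y hy z hz
  obtain ⟨g, rfl, hg⟩ := (mem_rep U).1 hy
  obtain ⟨h, rfl, hh⟩ := (mem_rep U).1 hz
  rw [rep_mem_rep]
  filter_upwards [hf, hg, hh] with i h1 h2 h3 using h1 _ h2 h3

theorem isOrdinal_rep {f : I → ZFSet.{u}}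
    (hf : ∀ᶠ i in (U : Filter I), (f i).IsOrdinal) : (rep U f).IsOrdinal := by
  rw [ZFSet.isOrdinal_iff_forall_mem_isTransitive]
  refine ⟨isTransitive_rep U (hf.mono fun _ h => h.isTransitive), fun y hy => ?_⟩
  obtain ⟨g, rfl, hg⟩ := (mem_rep U).1 hy
  refine isTransitive_rep U ?_
  filter_upwards [hf, hg] with i h1 h2 using (h1.mem h2).isTransitive

theorem le_rank_rep_const (o : Ordinal.{u}) : o ≤ (rep U fun _ => o.toZFSet).rank := by
  induction o using WellFoundedLT.induction with | _ o ih
  refine le_of_forall_lt fun a ha => (ih a ha).trans_lt (ZFSet.rank_lt_of_mem ?_)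
  rw [rep_mem_rep]
  exact .of_forall fun _ => Ordinal.toZFSet_mem_toZFSet_iff.2 ha

/-- The constant function `o + 1` represents an ordinal that is at least `o + 1`, hence has `o` as
an element; transitivity of `Ult U` does the rest. -/
theorem toZFSet_mem_Ult (o : Ordinal.{u}) : o.toZFSet ∈ Ult U := by
  have h : (rep U fun _ => (o + 1).toZFSet).IsOrdinal :=
    isOrdinal_rep U (.of_forall fun _ => ZFSet.isOrdinal_toZFSet _)
  refine isTransitive_Ult U (rep_mem_Ult U fun _ => (o + 1).toZFSet) ?_
  rw [← h.toZFSet_rank_eq, Ordinal.toZFSet_mem_toZFSet_iff]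
  exact (Order.lt_add_one_iff.2 le_rfl).trans_le (le_rank_rep_const U (o + 1))

end Ultrafilter

/-! ### Normality and closure under unions of size `δ` -/

section Normal

variable {δ : Cardinal.{u}} {U : Ultrafilter δ.ord.ToType}

theorem _root_.Ultrafilter.IsNormal.eventually_gt (hU : U.IsNormal) (α : δ.ord.ToType) :
    ∀ᶠ ξ in (U : Filter δ.ord.ToType), α < ξ := by
  have := hU.complete
  have hne : ∀ β, ∀ᶠ ξ in (U : Filter δ.ord.ToType), ¬ ξ = β := fun β =>
    Ultrafilter.eventually_not.2 (hU.nonprincipal β)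
  have hlt : ∀ᶠ ξ in (U : Filter δ.ord.ToType), ∀ β : Set.Iio α, ¬ ξ = β.1 :=
    (eventually_cardinal_forall (by simpa using mk_Iio_lt α (by simp))).2 fun β => hne β
  filter_upwards [hne α, hlt] with ξ h1 h2
  exact lt_of_le_of_ne (not_lt.1 fun h => h2 ⟨ξ, h⟩ rfl) (Ne.symm h1)

theorem _root_.Ultrafilter.IsNormal.exists_eventually_of_regressive (hU : U.IsNormal)
    {p : δ.ord.ToType → δ.ord.ToType → Prop}
    (hp : ∀ᶠ ξ in (U : Filter δ.ord.ToType), ∃ α < ξ, p α ξ) :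
    ∃ α, ∀ᶠ ξ in (U : Filter δ.ord.ToType), p α ξ := by
  by_contra! h
  have h' := hU.diagonal (fun α => {ξ | ¬ p α ξ}) h
  obtain ⟨ξ, ⟨α, hα, hpα⟩, hξ⟩ := (hp.and h').exists
  exact hξ α hα hpα

variable [CountableInterFilter (U : Filter δ.ord.ToType)]

/-- An element of the left side selects some `α < ξ` for almost every `ξ`; by normality one `α`
serves almost everywhere. Conversely, almost every `ξ` exceeds a given `α`. -/
theorem rep_diagonal_iUnion (hU : U.IsNormal) (f : δ.ord.ToType → δ.ord.ToType → ZFSet.{u}) :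
    rep U (fun ξ => ZFSet.iUnion fun α : Set.Iio ξ => f α ξ) =
      ZFSet.iUnion fun α => rep U (f α) := by
  ext z
  rw [ZFSet.mem_iUnion, mem_rep]
  constructor
  · rintro ⟨g, rfl, hg⟩
    simp only [ZFSet.mem_iUnion, Subtype.exists, Set.mem_Iio, exists_prop] at hg
    obtain ⟨α, hα⟩ := hU.exists_eventually_of_regressive hg
    exact ⟨α, (rep_mem_rep U).2 hα⟩
  · rintro ⟨α, hα⟩
    obtain ⟨g, rfl, hg⟩ := (mem_rep U).1 hα
    refine ⟨g, rfl, ?_⟩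
    filter_upwards [hg, hU.eventually_gt α] with ξ h1 h2
    exact ZFSet.mem_iUnion.2 ⟨⟨α, h2⟩, h1⟩

theorem iUnion_mem_Ult (hU : U.IsNormal) {ι : Type u} [Nonempty ι] (hι : #ι ≤ δ)
    {x : ι → ZFSet.{u}} (hx : ∀ a, x a ∈ Ult U) : ZFSet.iUnion x ∈ Ult U := by
  rw [← mk_ord_toType δ] at hι
  obtain ⟨e⟩ := hι
  choose f hf using fun a => (mem_Ult_iff U).1 (hx a)
  -- `Function.invFun e` maps `δ` onto `ι`, so the family is reindexed by `δ` with repetitions.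
  convert rep_mem_Ult U (fun ξ => ZFSet.iUnion fun α : Set.Iio ξ => f (Function.invFun e α) ξ)
    using 1
  rw [rep_diagonal_iUnion hU fun α ξ => f (Function.invFun e α) ξ]
  ext z
  simp only [ZFSet.mem_iUnion, hf, (Function.invFun_surjective e.injective).exists]

end Normal

end Ultrapower

/-! ### Complete filters, cofinal sequences and pigeonhole -/

open Filter in
theorem cardinalInterFilter_atTop {μ : Cardinal.{u}} (hμ : μ.IsRegular) :
    CardinalInterFilter (atTop : Filter μ.ord.ToType) μ where
  cardinal_sInter_mem S hS hmem := by
    have hne : Nonempty μ.ord.ToType := by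
      rw [Ordinal.nonempty_toType_iff, Ne, ord_eq_zero]
      exact hμ.pos.ne'
    choose b hb using fun s : S => mem_atTop_sets.1 (hmem s s.2)
    have hcof : ¬ IsCofinal (Set.range b) := fun h => by
      have h1 := Order.cof_le h
      rw [Ordinal.cof_toType, hμ.cof_ord] at h1
      exact (h1.trans mk_range_le).not_gt hS
    simp only [IsCofinal, Set.exists_range_iff, not_forall, not_exists, not_le] at hcof
    obtain ⟨a, ha⟩ := hcof
    refine mem_atTop_sets.2 ⟨a, fun c hc => Set.mem_sInter.2 fun s hs => ?_⟩
    exact hb ⟨s, hs⟩ c ((ha ⟨s, hs⟩).le.trans hc)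

open Filter in
theorem eventually_setOf_eq_of_decided {I α : Type u} {c : Cardinal.{u}} {F : Filter α} [F.NeBot]
    [CardinalInterFilter F c] (hI : #I < c) {P : I → α → Prop}
    (h : ∀ i, (∀ᶠ a in F, P i a) ∨ ∀ᶠ a in F, ¬ P i a) :
    ∀ᶠ a in F, {i | P i a} = {i | ∀ᶠ a in F, P i a} := by
  simp only [Set.ext_iff, Set.mem_ofPred_eq]
  refine (eventually_cardinal_forall hI).2 fun i => ?_
  rcases h i with hi | hi
  · exact hi.mono fun a ha => iff_of_true ha hi
  · refine hi.mono fun a ha => iff_of_false ha fun hi' => ?_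
    obtain ⟨b, h1, h2⟩ := (hi.and hi').exists
    exact h1 h2

theorem Ordinal.exists_monotone_cofinal (l : Ordinal.{u}) :
    ∃ s : l.cof.ord.ToType → Ordinal.{u}, Monotone s ∧ (∀ γ, s γ < l) ∧
      ∀ β < l, ∃ γ, β ≤ s γ := by
  obtain ⟨f, hf⟩ := Ordinal.exists_isFundamentalSeq (o := l) rfl
  refine ⟨fun γ => (f (Ordinal.ToType.mk.symm γ)).1, fun γ γ' h => ?_, fun γ => (f _).2,
    fun β hβ => ?_⟩
  · exact hf.strictMono.monotone (Ordinal.ToType.mk.symm.monotone h)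
  · obtain ⟨_, ⟨i, rfl⟩, hi⟩ := hf.isCofinal_range ⟨β, hβ⟩
    exact ⟨Ordinal.ToType.mk i, by simpa using Subtype.coe_le_coe.2 hi⟩

namespace ZFSet

theorem IsUnboundedSubset.lub_eq {A : ZFSet.{u}} {l : Ordinal.{u}} (hA : A.IsUnboundedSubset l)
    (hl : Order.IsSuccLimit l) : A.lub = l := by
  have hmem : l ∈ {β | ∀ γ : Ordinal.{u}, γ.toZFSet ∈ A → γ ≤ β} := fun γ hγ =>
    (Ordinal.toZFSet_mem_toZFSet_iff.1 (hA.1 hγ)).le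
  refine le_antisymm (csInf_le' hmem) (le_csInf ⟨l, hmem⟩ fun β hβ => ?_)
  by_contra! h
  obtain ⟨γ, h1, h2⟩ := hA.2 _ (hl.succ_lt h)
  exact ((Order.succ_le_iff.1 h1).trans_le (hβ γ h2)).false

end ZFSet

/-- Every initial segment of `A` that is bounded in `l` belongs to `M`. -/
def ZFSet.IsApproximatedIn (A : ZFSet.{u}) (M : Set ZFSet.{u}) (l : Ordinal.{u}) : Prop :=
  A ⊆ l.toZFSet ∧ ∀ α < l, A ∩ α.toZFSet ∈ M

theorem noFreshUnboundedSubset_of_approximated {M : Set ZFSet.{u}} {l : Ordinal.{u}}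
    (hl : Order.IsSuccLimit l) (h : ∀ A : ZFSet.{u}, A.IsApproximatedIn M l → A ∈ M) :
    NoFreshUnboundedSubset M l := fun A hA hf =>
  hf.2.1 (h A ⟨hA.1, hA.lub_eq hl ▸ hf.2.2⟩)

/-- Otherwise each fibre of `X` is bounded below `l`, and fewer than `cf(l)` such bounds have
supremum below `l`. -/
theorem exists_eq_forall_exists_le_of_lt_cof {ι T : Type u} {l : Ordinal.{u}} (hT : #T < l.cof)
    (X : ι → T) (s : ι → Ordinal.{u}) (hs : ∀ β < l, ∃ a, β ≤ s a) :
    ∃ t, ∀ β < l, ∃ a, X a = t ∧ β ≤ s a := by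
  by_contra! h
  choose b hb hb' using h
  obtain ⟨a, ha⟩ := hs _ (Ordinal.iSup_lt_of_lt_cof hT hb)
  exact ((hb' (X a) a rfl).trans_le (Ordinal.le_iSup b (X a))).not_ge ha

/-! ### Gluing the initial segments of `A` inside the ultrapower -/

namespace Ultrapower

open Filter

theorem mem_Ult_of_cof_le {δ : Cardinal.{u}} {U : Ultrafilter δ.ord.ToType}
    [CountableInterFilter (U : Filter δ.ord.ToType)] (hU : U.IsNormal) {l : Ordinal.{u}}
    (hl : Order.IsSuccLimit l) (hcof : l.cof ≤ δ) {A : ZFSet.{u}}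
    (hA : A.IsApproximatedIn (Ult U) l) : A ∈ Ult U := by
  obtain ⟨s, -, hsl, hs⟩ := l.exists_monotone_cofinal
  have hne : Nonempty l.cof.ord.ToType := ⟨(hs _ hl.bot_lt).choose⟩
  have h := iUnion_mem_Ult hU (by simpa using hcof) fun γ => hA.2 _ (hsl γ)
  convert h
  ext z
  simp only [ZFSet.mem_iUnion, ZFSet.mem_inter]
  refine ⟨fun hz => ?_, fun ⟨_, hz, _⟩ => hz⟩
  obtain ⟨β, hβ, rfl⟩ := Ordinal.mem_toZFSet_iff.1 (hA.1 hz)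
  obtain ⟨γ, hγ⟩ := hs _ (hl.succ_lt hβ)
  exact ⟨γ, hz, Ordinal.toZFSet_mem_toZFSet_iff.2 (Order.succ_le_iff.1 hγ)⟩

theorem eq_inter_of_forall_inter_eq {A B : ZFSet.{u}} {l : Ordinal.{u}} (hl : Order.IsSuccLimit l)
    (hA : A ⊆ l.toZFSet) (h : ∀ β < l, ∃ α, β ≤ α ∧ B ∩ α.toZFSet = A ∩ α.toZFSet) :
    A = B ∩ l.toZFSet := by
  have key : ∀ β < l, β.toZFSet ∈ A ↔ β.toZFSet ∈ B := by
    intro β hβ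
    obtain ⟨α, hα, he⟩ := h _ (hl.succ_lt hβ)
    have hm : β.toZFSet ∈ α.toZFSet :=
      Ordinal.toZFSet_mem_toZFSet_iff.2 (Order.succ_le_iff.1 hα)
    have := ZFSet.ext_iff.1 he β.toZFSet
    simpa [hm] using this.symm
  ext z
  rw [ZFSet.mem_inter]
  constructor
  · intro hz
    obtain ⟨β, hβ, rfl⟩ := Ordinal.mem_toZFSet_iff.1 (hA hz)
    exact ⟨(key β hβ).1 hz, hA hz⟩
  · rintro ⟨hz, hzl⟩
    obtain ⟨β, hβ, rfl⟩ := Ordinal.mem_toZFSet_iff.1 hzl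
    exact (key β hβ).2 hz

/-- If sufficiently complete filters on the index set of a cofinal sequence in `l` decide enough
sets, the coherent sequence of initial segments of `A` is uniformized in the ultrapower. -/
theorem mem_Ult_of_deciding_filter {I ι : Type u} (U : Ultrafilter I)
    [CountableInterFilter (U : Filter I)] {l : Ordinal.{u}} (hl : Order.IsSuccLimit l)
    (hcof : 2 ^ #I < l.cof) (s : ι → Ordinal.{u}) (hsl : ∀ a, s a < l)
    (hF : ∀ P : ι → I → ι → Prop, ∃ F : Filter ι, F.NeBot ∧
      CardinalInterFilter F (Order.succ #I) ∧ (∀ β < l, ∀ᶠ c in F, β ≤ s c) ∧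
      ∀ a i, (∀ᶠ c in F, P a i c) ∨ ∀ᶠ c in F, ¬ P a i c)
    {A : ZFSet.{u}} (hA : A.IsApproximatedIn (Ult U) l) : A ∈ Ult U := by
  choose f hf using fun a => (mem_Ult_iff U).1 (hA.2 _ (hsl a))
  choose g hg using fun a => (mem_Ult_iff U).1 (toZFSet_mem_Ult U (s a))
  obtain ⟨F, hne, hcompl, hs, hdec⟩ := hF fun a i c => f a i = f c i ∩ g a i
  have coh : ∀ a c, s a ≤ s c → ∀ᶠ i in (U : Filter I), f a i = f c i ∩ g a i := by
    intro a c hac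
    rw [← rep_eq_rep, rep_inter, hf, hf, hg]
    ext z
    have := @Ordinal.toZFSet_monotone _ _ hac z
    simp only [ZFSet.mem_inter]
    tauto
  let X : ι → Set I := fun a => {i | ∀ᶠ c in F, f a i = f c i ∩ g a i}
  have hX : ∀ a, ∀ᶠ c in F, {i | f a i = f c i ∩ g a i} = X a := fun a =>
    eventually_setOf_eq_of_decided (Order.lt_succ _) (hdec a)
  have hXU : ∀ a, X a ∈ U := by
    -- By completeness `X a` equals the coherence set of `a` with a single late `c`, and that set is
    -- in `U`.
    intro a
    obtain ⟨c, h1, h2⟩ := ((hX a).and (hs _ (hsl a))).exists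
    exact h1 ▸ coh a c h2
  obtain ⟨t, ht⟩ := exists_eq_forall_exists_le_of_lt_cof (by rwa [mk_set]) X s
    fun β hβ => (hs β hβ).exists
  let h : I → ZFSet.{u} := fun i => ZFSet.iUnion fun a : {a // X a = t} => f a i
  have hh : ∀ a, X a = t → rep U h ∩ (s a).toZFSet = A ∩ (s a).toZFSet := by
    intro a ha
    rw [← hf, ← hg, ← rep_inter, rep_eq_rep]
    filter_upwards [hXU a] with i hi
    ext z
    simp only [h, ZFSet.mem_inter, ZFSet.mem_iUnion, Subtype.exists, exists_prop]
    constructor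
    · rintro ⟨⟨b, hb, hz⟩, hza⟩
      have hib : i ∈ X b := by rwa [hb, ← ha]
      -- At `i ∈ t` a common `c` extends both `f a i` and `f b i`, so the part of `f b i` inside `g
      -- a i` lies in `f a i`.
      obtain ⟨c, hca, hcb⟩ := (hi.and hib).exists
      rw [hcb] at hz
      rw [hca]
      exact ZFSet.mem_inter.2 ⟨(ZFSet.mem_inter.1 hz).1, hza⟩
    · intro hz
      obtain ⟨c, hc⟩ := hi.exists
      exact ⟨⟨a, ha, hz⟩, (ZFSet.mem_inter.1 (hc ▸ hz)).2⟩
  rw [eq_inter_of_forall_inter_eq hl hA.1 fun β hβ => ?_]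
  · exact inter_mem_Ult U (rep_mem_Ult U h) (toZFSet_mem_Ult U l)
  · obtain ⟨a, ha, hβa⟩ := ht β hβ
    exact ⟨s a, hβa, hh a ha⟩

/-- The filter may depend on `P`: weak compactness yields a deciding filter only for one family of
sets at a time. -/
theorem mem_Ult_of_atTop_deciding_filter {I : Type u} (U : Ultrafilter I)
    [CountableInterFilter (U : Filter I)] {l : Ordinal.{u}} (hl : Order.IsSuccLimit l)
    (hcof : 2 ^ #I < l.cof)
    (hF : ∀ P : l.cof.ord.ToType → I → l.cof.ord.ToType → Prop,
      ∃ F : Filter l.cof.ord.ToType, F.NeBot ∧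
      CardinalInterFilter F (Order.succ #I) ∧ F ≤ atTop ∧
      ∀ a i, (∀ᶠ c in F, P a i c) ∨ ∀ᶠ c in F, ¬ P a i c)
    {A : ZFSet.{u}} (hA : A.IsApproximatedIn (Ult U) l) : A ∈ Ult U := by
  obtain ⟨s, hmono, hsl, hs⟩ := l.exists_monotone_cofinal
  refine mem_Ult_of_deciding_filter U hl hcof s hsl (fun P => ?_) hA
  obtain ⟨F, h1, h2, h3, h4⟩ := hF P
  refine ⟨F, h1, h2, fun β hβ => h3 ?_, h4⟩
  obtain ⟨γ, hγ⟩ := hs β hβ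
  exact (eventually_ge_atTop γ).mono fun c hc => hγ.trans (hmono hc)

theorem mem_Ult_of_complete_ultrafilter {I : Type u} (U : Ultrafilter I)
    [CountableInterFilter (U : Filter I)] {l : Ordinal.{u}} (hl : Order.IsSuccLimit l)
    (hcof : 2 ^ #I < l.cof) (F : Ultrafilter l.cof.ord.ToType)
    (hcompl : F.IsComplete (Order.succ #I)) (hF : (F : Filter l.cof.ord.ToType) ≤ atTop)
    {A : ZFSet.{u}} (hA : A.IsApproximatedIn (Ult U) l) : A ∈ Ult U :=
  mem_Ult_of_atTop_deciding_filter U hl hcof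
    (fun _ => ⟨F, inferInstance, hcompl, hF, fun _ _ => by
      rw [Ultrafilter.eventually_not]
      exact em _⟩) hA

end Ultrapower

open Filter

theorem exists_forall_lt_of_mk_lt {μ : Cardinal.{u}} (hμ : μ.IsRegular) {s : Set μ.ord.ToType}
    (hs : #s < μ) : ∃ a, ∀ t ∈ s, t < a := by
  by_contra! h
  have h1 := Order.cof_le (s := s) h
  rw [Ordinal.cof_toType, hμ.cof_ord] at h1
  exact h1.not_gt hs

theorem inf_principal_neBot_of_mk_eq {κ : Cardinal.{u}} (hκ : ℵ₀ ≤ κ) {H : Set κ.ord.ToType}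
    (hH : #H = κ) : (atTop ⊓ 𝓟 H : Filter κ.ord.ToType).NeBot := by
  have hne : Nonempty κ.ord.ToType := by
    rw [Ordinal.nonempty_toType_iff, Ne, ord_eq_zero]
    exact (aleph0_pos.trans_le hκ).ne'
  refine inf_principal_neBot_iff.2 fun s hs => ?_
  obtain ⟨a, ha⟩ := mem_atTop_sets.1 hs
  by_contra hempty
  have hsub : H ⊆ Set.Iio a := fun b hb => not_le.1 fun hab => hempty ⟨b, ha b hab, hb⟩
  have h1 : #(Set.Iio a) < κ := by simpa using mk_Iio_lt a (by simp)
  exact ((mk_le_mk_of_subset hsub).trans_lt h1).ne hH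

/-! ### Deciding filters from weak compactness -/

namespace Cardinal.IsWeaklyCompact

variable {κ : Cardinal.{u}}

/-- Along a set `H` homogeneous for lexicographic comparison the sequences `x γ` are monotone. By
induction on `ξ`, once all earlier coordinates have stabilized, coordinate `ξ` is monotone in `γ`
and so stabilizes too. -/
theorem exists_deciding_filter_toType (hκ : κ.IsWeaklyCompact) (hreg : κ.IsRegular)
    (x : κ.ord.ToType → κ.ord.ToType → Bool) :
    ∃ F : Filter κ.ord.ToType, F.NeBot ∧ CardinalInterFilter F κ ∧ F ≤ atTop ∧
      ∀ ξ, ∃ v, ∀ᶠ γ in F, x γ ξ = v := by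
  classical
  obtain ⟨H, b, hH, hb⟩ := hκ.2 fun α β => decide (toLex (x α) ≤ toLex (x β))
  have := cardinalInterFilter_atTop hreg
  have hF : (atTop ⊓ 𝓟 H : Filter κ.ord.ToType).NeBot := inf_principal_neBot_of_mk_eq hκ.1.le hH
  have := noMaxOrder hκ.1.le
  refine ⟨atTop ⊓ 𝓟 H, hF, inferInstance, inf_le_left, fun ξ => ?_⟩
  induction ξ using WellFoundedLT.induction with | _ ξ ih
  choose v hv using ih
  have hE : ∀ᶠ γ in atTop ⊓ 𝓟 H, ∀ η : Set.Iio ξ, x γ η = v η η.2 :=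
    (eventually_cardinal_forall (by simpa using mk_Iio_lt ξ (by simp))).2 fun η => hv η η.2
  have hmem : ∀ᶠ γ in atTop ⊓ 𝓟 H, γ ∈ H := mem_inf_of_right (mem_principal_self H)
  -- The colour `b` is also the value that persists: `true` when the sequences increase, `false`
  -- when they decrease.
  by_cases hfr : ∃ᶠ γ in atTop ⊓ 𝓟 H, x γ ξ = b
  · obtain ⟨γ₀, h0, hE0, hH0⟩ := (hfr.and_eventually (hE.and hmem)).exists
    refine ⟨b, ?_⟩
    filter_upwards [hE, hmem, mem_inf_of_left (eventually_gt_atTop γ₀)] with γ hEγ hHγ hγ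
    have hagree : ∀ η < ξ, x γ₀ η = x γ η := fun η hη =>
      (hE0 ⟨η, hη⟩).trans (hEγ ⟨η, hη⟩).symm
    have hc := hb γ₀ hH0 γ hHγ hγ
    cases b
    · have hle := Pi.apply_le_of_toLex (not_le.1 (of_decide_eq_false hc)).le
        fun η hη => (hagree η hη).symm
      rw [h0] at hle
      exact Bool.eq_false_of_le_false hle
    · have hle := Pi.apply_le_of_toLex (of_decide_eq_true hc) hagree
      rw [h0] at hle
      exact Bool.eq_true_of_true_le hle
  · exact ⟨!b, (not_frequently.1 hfr).mono fun γ hγ => Bool.eq_not.2 hγ⟩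

theorem exists_deciding_filter (hκ : κ.IsWeaklyCompact) (hreg : κ.IsRegular) {ι : Type u}
    (hι : #ι ≤ κ) (P : ι → κ.ord.ToType → Prop) :
    ∃ F : Filter κ.ord.ToType, F.NeBot ∧ CardinalInterFilter F κ ∧ F ≤ atTop ∧
      ∀ a, (∀ᶠ γ in F, P a γ) ∨ ∀ᶠ γ in F, ¬ P a γ := by
  classical
  rw [← mk_ord_toType κ] at hι
  obtain ⟨e⟩ := hι
  obtain ⟨F, h1, h2, h3, h4⟩ := exists_deciding_filter_toType hκ hreg
    fun γ ξ => decide (∃ a, e a = ξ ∧ P a γ)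
  refine ⟨F, h1, h2, h3, fun a => ?_⟩
  obtain ⟨v, hv⟩ := h4 (e a)
  simp only [e.injective.eq_iff, exists_eq_left] at hv
  cases v
  · exact Or.inr (hv.mono fun γ => of_decide_eq_false)
  · exact Or.inl (hv.mono fun γ => of_decide_eq_true)

/-- Given `κ` distinct subsets of `δ`, a filter deciding membership of each `i < δ` makes them
constant on a filter set, which is unbounded. -/
theorem two_power_lt (hκ : κ.IsWeaklyCompact) (hreg : κ.IsRegular) {δ : Cardinal.{u}}
    (hδ : δ < κ) : 2 ^ δ < κ := by
  by_contra! h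
  rw [← mk_ord_toType κ, ← mk_ord_toType δ, ← mk_set] at h
  obtain ⟨e⟩ := h
  obtain ⟨F, h1, h2, h3, h4⟩ := hκ.exists_deciding_filter hreg
    (by simpa using hδ.le) fun (i : δ.ord.ToType) γ => i ∈ e γ
  have hconst := eventually_setOf_eq_of_decided (by simpa using hδ) h4
  have := noMaxOrder hκ.1.le
  obtain ⟨γ₀, h0⟩ := hconst.exists
  obtain ⟨γ, hγ, hγ'⟩ := (hconst.and (h3 (eventually_gt_atTop γ₀))).exists
  exact hγ'.ne (e.injective (h0.trans hγ.symm))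

end Cardinal.IsWeaklyCompact

/-! ### Complete ultrafilters from strong compactness -/

namespace Cardinal.IsStronglyCompact

variable {κ : Cardinal.{u}}

/-- If `κ ≤ 2^δ`, choose for each small family `s` of subsets of `δ` a set `f s ∉ s`. Completeness
makes `f` constant almost everywhere, and fineness puts that constant value in almost every `s`. -/
theorem two_power_lt (hκ : κ.IsStronglyCompact) {δ : Cardinal.{u}} (hδ : δ < κ) : 2 ^ δ < κ := by
  by_contra! h
  rw [← mk_ord_toType δ, ← mk_set] at h
  obtain ⟨W, hW, hfine⟩ := hκ.2 _ h
  have hout : ∀ s : {s : Set (Set δ.ord.ToType) // #s < κ}, ∃ a, a ∉ s.1 := by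
    intro s
    by_contra! hs
    have hlt := s.2
    rw [Set.eq_univ_of_forall hs, mk_univ] at hlt
    exact hlt.not_ge h
  choose f hf using hout
  have hconst := eventually_setOf_eq_of_decided (F := (W : Filter _)) (c := κ)
    (P := fun (i : δ.ord.ToType) s => i ∈ f s) (by simpa using hδ) fun i => by
      rw [Ultrafilter.eventually_not]
      exact em _
  obtain ⟨s, h1, h2⟩ :=
    (hconst.and (hfine {i | ∀ᶠ s in (W : Filter _), i ∈ f s})).exists
  rw [← h1, Set.ofPred_mem_eq] at h2
  exact hf s h2

/-- Push the fine ultrafilter forward along a choice of strict upper bounds: fineness at `a` puts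
the tail above `a` in the image. -/
theorem exists_ultrafilter_le_atTop (hκ : κ.IsStronglyCompact) {μ : Cardinal.{u}}
    (hμ : μ.IsRegular) (hle : κ ≤ μ) :
    ∃ F : Ultrafilter μ.ord.ToType, F.IsComplete κ ∧ (F : Filter μ.ord.ToType) ≤ atTop := by
  obtain ⟨W, hW, hfine⟩ := hκ.2 μ.ord.ToType (by simpa using hle)
  choose f hf using fun s : {s : Set μ.ord.ToType // #s < κ} =>
    exists_forall_lt_of_mk_lt hμ (s.2.trans_le hle)
  refine ⟨W.map f, inferInstanceAs (CardinalInterFilter (Filter.map f W) κ), ?_⟩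
  refine le_iInf fun a => le_principal_iff.2 ?_
  exact (show ∀ᶠ s in (W : Filter _), a ≤ f s from
    Filter.Eventually.mono (hfine a) fun s hs => (hf s a hs).le)

end Cardinal.IsStronglyCompact

theorem mainTheorem11 (δ : Cardinal.{u}) (hδ : δ.IsMeasurable)
    (U : Ultrafilter δ.ord.ToType) (hU : U.IsNormal)
    (l : Ordinal.{u}) (hl : Order.IsSuccLimit l) :
    haveI : CountableInterFilter (U : Filter δ.ord.ToType) := hU.countableInterFilter hδ
    (l.cof < Order.succ δ ∨ l.cof.IsWeaklyCompact →
      NoFreshUnboundedSubset (Ultrapower.Ult U) l) ∧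
    (2 ^ δ < l.cof →
      (∃ F : Ultrafilter l.cof.ord.ToType,
        F.IsComplete (Order.succ (2 ^ δ)) ∧ F.ContainsCobounded) →
      NoFreshUnboundedSubset (Ultrapower.Ult U) l) ∧
    ((∃ κ : Cardinal.{u}, κ.IsStronglyCompact ∧ δ < κ ∧ κ ≤ l.cof) →
      NoFreshUnboundedSubset (Ultrapower.Ult U) l) := by
  have : CountableInterFilter (U : Filter δ.ord.ToType) := hU.countableInterFilter hδ
  have hreg := isRegular_cof hl
  refine ⟨fun h => ?_, fun hcof ⟨F, hF, hcb⟩ => ?_, fun ⟨κ, hκ, hδκ, hle⟩ => ?_⟩ <;>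
    refine noFreshUnboundedSubset_of_approximated hl fun A hA => ?_
  · by_cases hcof : l.cof ≤ δ
    · exact Ultrapower.mem_Ult_of_cof_le hU hl hcof hA
    have hwc := h.resolve_left fun h => hcof (Order.lt_succ_iff.1 h)
    have hδl := not_le.1 hcof
    refine Ultrapower.mem_Ult_of_atTop_deciding_filter U hl
      (by simpa using hwc.two_power_lt hreg hδl) (fun P => ?_) hA
    -- One filter has to decide all pairs `(a, i)`; there are only `cf(l) · δ = cf(l)` of them.
    obtain ⟨F, h1, h2, h3, h4⟩ := hwc.exists_deciding_filter hreg
      (ι := l.cof.ord.ToType × δ.ord.ToType) (by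
        rw [mk_prod, lift_id, lift_id, mk_ord_toType, mk_ord_toType]
        exact mul_le_of_le hreg.1 le_rfl hδl.le) fun p c => P p.1 p.2 c
    refine ⟨F, h1, ?_, h3, fun a i => h4 (a, i)⟩
    exact .of_cardinalInterFilter_of_le F (by simpa using hδl)
  · have hle : Order.succ #δ.ord.ToType ≤ Order.succ (2 ^ δ) := by
      simpa using (cantor δ).le
    refine Ultrapower.mem_Ult_of_complete_ultrafilter U hl (by simpa using hcof) F
      (CardinalInterFilter.of_cardinalInterFilter_of_le (F : Filter l.cof.ord.ToType) hle) ?_ hA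
    exact le_iInf fun a => le_principal_iff.2 (hcb _ ⟨a, fun _ h => h⟩)
  · obtain ⟨F, hF, hF'⟩ := hκ.exists_ultrafilter_le_atTop hreg hle
    refine Ultrapower.mem_Ult_of_complete_ultrafilter U hl
      (by simpa using (hκ.two_power_lt hδκ).trans_le hle) F ?_ hF' hA
    have hle' : Order.succ #δ.ord.ToType ≤ κ := by simpa using hδκ
    exact CardinalInterFilter.of_cardinalInterFilter_of_le (F : Filter l.cof.ord.ToType) hle'
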